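/- Let $P(X)=a_dX^d+\cdots+a_0\in\mathbb Z[X]$ with $d\ge 1$, $a_d\ge 1$, satisfy: (i) $\gcd(a_d,\ldots,a_0)=1$ and $a_0\neq 0$; (ii) $P$ has no multiple roots; (iii) every irreducible factor of $P$ in $\mathbb Z[X]$ has at least one complex root of modulus greater than $1$. Let $\alpha_1,\ldots,\alpha_p$ be the (distinct) complex roots of $P$ of modulus greater than $1$. For an integer $k\ge 0$ let $\Xi_k$ be the set of tuples $\mathbf g=(g_1,\ldots,g_p)$ of polynomials in $\mathbb C[X]$ of degree at most $k$ such that $g_i\in\mathbb R[X]$ whenever $\alpha_i\in\mathbb R$, and $g_j=\overline{g_i}$ (coefficientwise conjugation) whenever $\alpha_j=\overline{\alpha_i}$. For $\mathbf g\in\Xi_k$ put $$x_n(\mathbf g)=\sum_{i=1}^p g_i(n)\alpha_i^n\in\mathbb R\qquad(n\in\mathbb Z),$$ and let $$\mathcal L^{(k)}(P)=\Bigl\{\limsup_{n\to\infty}\|x_n(\mathbf g)\| \;:\; \mathbf g\in\Xi_k\Bigr\},$$ where $\|x\|$ is the distance from $x\in\mathbb R$ to the nearest integer. Call $P$ hyperbolic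 if no complex root of $P$ has modulus $1$. **Theorem.** Suppose in addition that $P$ is monic, and let $k\ge 0$ be an integer. Then $0$ is an isolated point of $\mathcal L^{(k)}(P)$ if and only if $P$ is hyperbolic. Moreover, if $P$ is not hyperbolic, then $\mathcal L^{(k)}(P)$ is a dense subset of $[0,1/2]$. -/

import Mathlib

open Polynomial Filter Set

noncomputable section

namespace MarkoffLagrange

/-- The distance from a real number to the nearest integer. -/
def distInt (x : ℝ) : ℝ := |x - round x|

/-- The complex roots of an integer polynomial, each listed once. -/
def rootSetC (P : ℤ[X]) : Finset ℂ := (P.map (Int.castRingHom ℂ)).roots.toFinset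

/-- The expanding roots, i.e. the complex roots of modulus greater than one. -/
def expandingRoots (P : ℤ[X]) : Finset ℂ := (rootSetC P).filter (fun z => 1 < ‖z‖)

/-- The standing assumptions on the integer polynomial `P`: it has degree at least one, positive
leading coefficient, coprime coefficients, nonzero constant term, no multiple root, and every
irreducible factor of it in `ℤ[X]` has a root of modulus greater than one. -/
structure Admissible (P : ℤ[X]) : Prop where
  one_le_natDegree : 1 ≤ P.natDegree
  one_le_leadingCoeff : 1 ≤ P.leadingCoeff
  isPrimitive : P.IsPrimitive
  coeff_zero_ne_zero : P.coeff 0 ≠ 0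
  nodup_roots : (P.map (Int.castRingHom ℂ)).roots.Nodup
  exists_expanding_root :
    ∀ Q : ℤ[X], Irreducible Q → Q ∣ P → ∃ z : ℂ, aeval z Q = 0 ∧ 1 < ‖z‖

/-- `P` is hyperbolic when no complex root of it lies on the unit circle. -/
def Hyperbolic (P : ℤ[X]) : Prop := ∀ z ∈ rootSetC P, ‖z‖ ≠ 1

/-- The coefficient families: one complex polynomial of degree at most `k` for each expanding root,
with real coefficients at the real roots, and with conjugate polynomials at conjugate roots. The
family is written as a function on `ℂ`; its values off the expanding roots are never used. -/
def coeffFamilies (P : ℤ[X]) (k : ℕ) : Set (ℂ → ℂ[X]) :=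
  {g | ∀ α ∈ expandingRoots P,
      (g α).degree ≤ (k : WithBot ℕ) ∧
      (α.im = 0 → ∃ q : ℝ[X], g α = q.map Complex.ofRealHom) ∧
      g (starRingEnd ℂ α) = (g α).map (starRingEnd ℂ)}

/-- The sum of `g_α(n) α ^ n` over the expanding roots `α`, as a complex number. -/
def recSumC (P : ℤ[X]) (g : ℂ → ℂ[X]) (n : ℤ) : ℂ :=
  ∑ α ∈ expandingRoots P, (g α).eval (n : ℂ) * α ^ n

/-- The bi-infinite real sequence `x_n(g)`. Taking the real part loses nothing,
see `coe_recSeq`. -/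
def recSeq (P : ℤ[X]) (g : ℂ → ℂ[X]) (n : ℤ) : ℝ := (recSumC P g n).re

/-- The spectrum: all values of `limsup ‖x_n(g)‖` as `n → ∞`, where `‖·‖` is the distance to the
nearest integer and `g` runs over the coefficient families of degree at most `k`. -/
def spectrumL (P : ℤ[X]) (k : ℕ) : Set ℝ :=
  {t | ∃ g ∈ coeffFamilies P k,
      t = limsup (fun n : ℕ => distInt (recSeq P g (n : ℤ))) atTop}

/-- `x` is an isolated point of the set `S` of reals: it lies in `S` and some neighbourhood of it
contains no other point of `S`. -/
def IsIsolatedPoint (x : ℝ) (S : Set ℝ) : Prop :=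
  x ∈ S ∧ ∃ ε > 0, ∀ y ∈ S, |y - x| < ε → y = x

/-- `A` is a dense subset of the set `B` of reals. -/
def IsDenseIn (A B : Set ℝ) : Prop := A ⊆ B ∧ B ⊆ closure A

theorem conj_mem_rootSetC {P : ℤ[X]} {z : ℂ} (hz : z ∈ rootSetC P) :
    starRingEnd ℂ z ∈ rootSetC P := by
  simp only [rootSetC, Multiset.mem_toFinset, mem_roots', IsRoot.def] at hz ⊢
  refine ⟨hz.1, ?_⟩
  have h := congrArg (starRingEnd ℂ) hz.2
  rw [← eval_map_apply, Polynomial.map_map] at h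
  simpa [RingHom.ext_int ((starRingEnd ℂ).comp (Int.castRingHom ℂ)) (Int.castRingHom ℂ)] using h

theorem conj_mem_expandingRoots {P : ℤ[X]} {z : ℂ} (hz : z ∈ expandingRoots P) :
    starRingEnd ℂ z ∈ expandingRoots P := by
  simp only [expandingRoots, Finset.mem_filter] at hz ⊢
  exact ⟨conj_mem_rootSetC hz.1, by simpa using hz.2⟩

/-- For a coefficient family the defining sum is real. -/
theorem coe_recSeq {P : ℤ[X]} {k : ℕ} {g : ℂ → ℂ[X]} (hg : g ∈ coeffFamilies P k) (n : ℤ) :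
    ((recSeq P g n : ℝ) : ℂ) = recSumC P g n := by
  have h : starRingEnd ℂ (recSumC P g n) = recSumC P g n := by
    unfold recSumC
    rw [map_sum]
    refine Finset.sum_nbij' (starRingEnd ℂ) (starRingEnd ℂ)
      (fun _ h => conj_mem_expandingRoots h) (fun _ h => conj_mem_expandingRoots h)
      (by simp) (by simp) ?_
    intro α hα
    rw [(hg α hα).2.2, map_mul, map_zpow₀, ← eval_map_apply]
    simp
  exact Complex.conj_eq_iff_re.mp h

end MarkoffLagrange

end

/-!
Let `T` be the shift on sequences and `x = x(g)`, and let `e` be the difference between `x` and the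
sequence of nearest integers. Since `P(T) ^ (k + 1)` kills `x`, it maps `e` to an integer sequence;
if `limsup |e|` is small, that integer sequence vanishes eventually, and then `e → 0` when `P` has
no root on the unit circle, because `L = limsup |y|` satisfies `L = |a| L` whenever
`(T - a) y → 0`. So `0` is isolated in the hyperbolic case.

In the other case, weighted power sums `∑ c(β) β ^ n` over all roots with `c(β) = m(β) (β ^ h - 1)`,
`m` the multiplicity, are integers. So, up to a null sequence from the contracting roots, the
sequence of the constant family `c` differs from an integer sequence by the sum of `-c(β) β ^ n`
over the roots on the unit circle. By recurrence in a compact torus `h` can be chosen to make these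
errors arbitrarily small, and they do not tend to `0` unless every `c(β)` with `|β| = 1` vanishes,
that is, unless all these roots are roots of unity. Natural multiples of `c` then yield a fine mesh
of points of the spectrum in `[0, 1/2]`.
-/

open scoped Topology

namespace MarkoffLagrange

section Limsup

variable {ι : Type*} {f : Filter ι} {u v : ι → ℝ}

theorem isBoundedUnder_ge_of_nonneg (hu : ∀ i, 0 ≤ u i) : f.IsBoundedUnder (· ≥ ·) u :=
  isBoundedUnder_of ⟨0, hu⟩

theorem limsup_const_mul_of_nonneg [f.NeBot] {c : ℝ} (hc : 0 ≤ c)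
    (hu : f.IsBoundedUnder (· ≤ ·) u) (hu' : f.IsBoundedUnder (· ≥ ·) u) :
    limsup (fun i => c * u i) f = c * limsup u f :=
  ((monotone_mul_left_of_nonneg hc).map_limsup_of_continuousAt u
    (continuous_const_mul c).continuousAt hu hu'.isCoboundedUnder_le).symm

theorem limsup_eq_of_tendsto_sub [f.NeBot] (hv : f.IsBoundedUnder (· ≤ ·) v)
    (hv' : f.IsBoundedUnder (· ≥ ·) v) (h : Tendsto (u - v) f (𝓝 0)) :
    limsup u f = limsup v f := by
  have hle : limsup (v + (u - v)) f ≤ limsup v f + limsup (u - v) f :=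
    limsup_add_le hv' hv h.isCoboundedUnder_le h.isBoundedUnder_le
  have hge : limsup v f + liminf (u - v) f ≤ limsup (v + (u - v)) f :=
    le_limsup_add hv hv'.isCoboundedUnder_le h.isBoundedUnder_le h.isBoundedUnder_ge
  rw [add_sub_cancel, h.limsup_eq, add_zero] at hle
  rw [add_sub_cancel, h.liminf_eq, add_zero] at hge
  exact hle.antisymm hge

theorem tendsto_zero_of_limsup_norm_le_zero {E : Type*} [SeminormedAddCommGroup E] {y : ι → E}
    (hy : f.IsBoundedUnder (· ≤ ·) fun i => ‖y i‖) (h : limsup (fun i => ‖y i‖) f ≤ 0) :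
    Tendsto y f (𝓝 0) := by
  refine tendsto_zero_iff_norm_tendsto_zero.2 (tendsto_order.2 ⟨fun a ha => ?_, fun a ha => ?_⟩)
  · exact Eventually.of_forall fun i => ha.trans_le (norm_nonneg _)
  · exact eventually_lt_of_limsup_lt (h.trans_lt ha) hy

end Limsup

theorem Icc_subset_closure_of_natCast_mul_mem {S : Set ℝ} {b : ℝ} (hb : 0 < b)
    (hS : ∀ δ > 0, ∃ L, 0 < L ∧ L < δ ∧ ∀ m : ℕ, m * L < b → m * L ∈ S) :
    Icc 0 b ⊆ closure S := by
  suffices Ico 0 b ⊆ closure S by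
    rw [← closure_Ico hb.ne]
    exact closure_minimal this isClosed_closure
  rintro t ⟨ht0, htb⟩
  refine Metric.mem_closure_iff.2 fun δ hδ => ?_
  obtain ⟨L, hL0, hLδ, hL⟩ := hS δ hδ
  have hle : ⌊t / L⌋₊ * L ≤ t := (le_div_iff₀ hL0).1 (Nat.floor_le (by positivity))
  have hlt : t < (⌊t / L⌋₊ + 1) * L := (div_lt_iff₀ hL0).1 (Nat.lt_floor_add_one _)
  refine ⟨⌊t / L⌋₊ * L, hL _ (hle.trans_lt htb), ?_⟩
  rw [Real.dist_eq, abs_of_nonneg (sub_nonneg.2 hle)]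
  linarith

theorem IsDenseIn.not_isIsolatedPoint {S : Set ℝ} {a b : ℝ} (hab : a < b)
    (h : IsDenseIn S (Icc a b)) : ¬ IsIsolatedPoint a S := by
  rintro ⟨-, ε, hε, hiso⟩
  obtain ⟨t, hat, ht⟩ := exists_between (lt_min hab (lt_add_of_pos_right a hε))
  have htcl : t ∈ closure S := h.2 ⟨hat.le, (ht.trans_le (min_le_left _ _)).le⟩
  obtain ⟨y, ⟨hay, hyε⟩, hyS⟩ :=
    mem_closure_iff.1 htcl (Ioo a (a + ε)) isOpen_Ioo ⟨hat, ht.trans_le (min_le_right _ _)⟩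
  refine hay.ne' (hiso y hyS ?_)
  rw [abs_of_pos (sub_pos.2 hay)]
  linarith

section CommRing

variable (R : Type*) {S : Type*} [CommRing R] [CommRing S]

/-- The shift operator `(yₙ) ↦ (yₙ₊₁)` on sequences. For a polynomial `p`, the sequences killed by
`aeval (shift R) p` are the solutions of the linear recurrence with characteristic polynomial
`p`. -/
def shift : Module.End R (ℕ → R) := LinearMap.funLeft R R Nat.succ

variable {R}

theorem shift_apply (y : ℕ → R) (n : ℕ) : shift R y n = y (n + 1) := rfl

theorem shift_pow_apply (i : ℕ) (y : ℕ → R) (n : ℕ) : (shift R ^ i) y n = y (n + i) := by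
  induction i generalizing n with
  | zero => rfl
  | succ i ih => rw [pow_succ', Module.End.mul_apply, shift_apply, ih, add_right_comm, add_assoc]

theorem aeval_shift_apply (p : R[X]) (y : ℕ → R) (n : ℕ) :
    aeval (shift R) p y n = p.sum fun i a => a * y (n + i) := by
  simp [aeval_eq_sum_range, sum_over_range, shift_pow_apply]

theorem aeval_shift_X_sub_C_apply (a : R) (y : ℕ → R) (n : ℕ) :
    aeval (shift R) (X - C a) y n = y (n + 1) - a * y n := by
  simp [shift_apply, Module.algebraMap_end_apply]

theorem aeval_shift_map_apply (f : R →+* S) (p : R[X]) (y : ℕ → R) (n : ℕ) :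
    aeval (shift S) (p.map f) (fun i => f (y i)) n = f (aeval (shift R) p y n) := by
  have hsum : (p.map f).sum (fun i a => a * f (y (n + i))) =
      p.sum fun i a => f a * f (y (n + i)) :=
    (sum_eq_of_subset _ (by simp) (support_map_subset f p)).trans
      (Finset.sum_congr rfl fun i _ => by rw [coeff_map])
  rw [aeval_shift_apply, aeval_shift_apply, hsum]
  simp [Polynomial.sum]

theorem aeval_shift_geometric (p : R[X]) (c z : R) :
    aeval (shift R) p (fun n => c * z ^ n) = fun n => p.eval z * c * z ^ n := by
  funext n
  simp only [aeval_shift_apply, eval_eq_sum, Polynomial.sum, Finset.sum_mul]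
  exact Finset.sum_congr rfl fun i _ => by ring

theorem aeval_shift_X_sub_C_pow_eq_zero (a : R) {m : ℕ} {q : R[X]} (hq : q.degree < m) :
    aeval (shift R) ((X - C a) ^ m) (fun n => q.eval (n : R) * a ^ n) = 0 := by
  induction m generalizing q with
  | zero =>
    have : q = 0 := by simpa using hq
    simp [this, Pi.zero_def]
  | succ m ih =>
    have hstep : aeval (shift R) (X - C a) (fun n => q.eval (n : R) * a ^ n) =
        fun n : ℕ => (a • (taylor 1 q - q)).eval (n : R) * a ^ n := by
      funext n
      rw [aeval_shift_X_sub_C_apply]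
      simp only [eval_smul, eval_sub, taylor_eval, Nat.cast_succ, smul_eq_mul]
      rw [add_comm (n : R) 1]
      ring
    rw [pow_succ, map_mul, Module.End.mul_apply, hstep]
    rcases eq_or_ne q 0 with rfl | hq0
    · simpa [Pi.zero_def] using ih (q := 0) (by simp)
    · have hdeg : (taylor 1 q - q).degree < q.degree := by
        simpa using degree_sub_lt_left (degree_taylor q 1) (by simpa) (leadingCoeff_taylor 1 q)
      have hle : q.degree ≤ m :=
        degree_le_of_natDegree_le (Nat.lt_succ_iff.1 ((natDegree_lt_iff_degree_lt hq0).2 hq))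
      exact ih ((degree_smul_le a _).trans_lt (hdeg.trans_le hle))

theorem aeval_shift_pow_eq_zero_of_isRoot {p : R[X]} {a : R} (ha : p.IsRoot a) {k : ℕ} {q : R[X]}
    (hq : q.degree ≤ k) :
    aeval (shift R) (p ^ (k + 1)) (fun n => q.eval (n : R) * a ^ n) = 0 := by
  obtain ⟨r, hr⟩ := pow_dvd_pow_of_dvd (dvd_iff_isRoot.2 ha) (k + 1)
  have hlt : q.degree < (k + 1 : ℕ) := hq.trans_lt (by exact_mod_cast k.lt_succ_self)
  rw [hr, mul_comm, map_mul, Module.End.mul_apply, aeval_shift_X_sub_C_pow_eq_zero a hlt, map_zero]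

end CommRing

section NormedField

variable {𝕜 : Type*} [NormedField 𝕜] {y : ℕ → 𝕜}

theorem tendsto_aeval_shift (p : 𝕜[X]) (hy : Tendsto y atTop (𝓝 0)) :
    Tendsto (aeval (shift 𝕜) p y) atTop (𝓝 0) := by
  rw [funext (aeval_shift_apply p y)]
  simpa [Polynomial.sum] using tendsto_finsetSum p.support fun i _ =>
    ((tendsto_add_atTop_iff_nat i).2 hy).const_mul (p.coeff i)

theorem norm_aeval_shift_le (p : 𝕜[X]) {B : ℝ} {n : ℕ} (hy : ∀ i ≥ n, ‖y i‖ ≤ B) :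
    ‖aeval (shift 𝕜) p y n‖ ≤ (p.sum fun _ a => ‖a‖) * B := by
  rw [aeval_shift_apply, Polynomial.sum, Polynomial.sum, Finset.sum_mul]
  refine norm_sum_le_of_le _ fun i _ => ?_
  rw [norm_mul]
  gcongr
  exact hy _ (Nat.le_add_right n i)

theorem isBoundedUnder_norm_aeval_shift (p : 𝕜[X])
    (hy : IsBoundedUnder (· ≤ ·) atTop fun n => ‖y n‖) :
    IsBoundedUnder (· ≤ ·) atTop fun n => ‖aeval (shift 𝕜) p y n‖ := by
  obtain ⟨B, hB⟩ := hy
  obtain ⟨N, hN⟩ := eventually_atTop.1 (eventually_map.1 hB)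
  exact isBoundedUnder_of_eventually_le <| eventually_atTop.2
    ⟨N, fun n hn => norm_aeval_shift_le p fun i hi => hN i (hn.trans hi)⟩

theorem tendsto_zero_of_tendsto_sub_mul {a : 𝕜} (ha : ‖a‖ ≠ 1)
    (hy : IsBoundedUnder (· ≤ ·) atTop fun n => ‖y n‖)
    (h : Tendsto (fun n => y (n + 1) - a * y n) atTop (𝓝 0)) : Tendsto y atTop (𝓝 0) := by
  have hy' : IsBoundedUnder (· ≥ ·) atTop fun n => ‖y n‖ :=
    isBoundedUnder_ge_of_nonneg fun n => norm_nonneg _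
  have hshift : IsBoundedUnder (· ≤ ·) atTop fun n => ‖y (n + 1)‖ :=
    (tendsto_add_atTop_nat 1).isBoundedUnder_comp hy
  have hdiff : Tendsto ((fun n => ‖a‖ * ‖y n‖) - fun n => ‖y (n + 1)‖) atTop (𝓝 0) := by
    refine squeeze_zero_norm (fun n => ?_) (tendsto_zero_iff_norm_tendsto_zero.1 h)
    simpa [norm_sub_rev] using abs_norm_sub_norm_le (a * y n) (y (n + 1))
  have hfix : ‖a‖ * limsup (fun n => ‖y n‖) atTop = limsup (fun n => ‖y n‖) atTop := by
    rw [← limsup_const_mul_of_nonneg (norm_nonneg a) hy hy', ← limsup_nat_add (fun n => ‖y n‖) 1]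
    exact limsup_eq_of_tendsto_sub hshift (isBoundedUnder_ge_of_nonneg fun n => norm_nonneg _) hdiff
  have hlim : limsup (fun n => ‖y n‖) atTop = 0 := by
    by_contra hne
    exact ha ((mul_eq_right₀ hne).1 hfix)
  exact tendsto_zero_of_limsup_norm_le_zero hy hlim.le

theorem tendsto_zero_of_tendsto_aeval_shift {p : 𝕜[X]} (hp : p.Splits) (hp0 : p ≠ 0)
    (hroots : ∀ a, p.IsRoot a → ‖a‖ ≠ 1) (hy : IsBoundedUnder (· ≤ ·) atTop fun n => ‖y n‖)
    (h : Tendsto (aeval (shift 𝕜) p y) atTop (𝓝 0)) : Tendsto y atTop (𝓝 0) := by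
  induction hp using Submonoid.closure_induction generalizing y with
  | mem q hq =>
    obtain ⟨r, rfl⟩ | ⟨a, rfl⟩ := hq
    · have hr : r ≠ 0 := by simpa using hp0
      simpa [Module.algebraMap_end_apply, hr, Pi.smul_def] using h.const_smul r⁻¹
    · have hshift : aeval (shift 𝕜) (X + C a) y = fun n => y (n + 1) - -a * y n :=
        funext fun n => by simpa using aeval_shift_X_sub_C_apply (-a) y n
      exact tendsto_zero_of_tendsto_sub_mul (hroots (-a) (by simp)) hy (hshift ▸ h)
  | one => simpa using h
  | mul q r _ _ ihq ihr =>
    rw [map_mul, Module.End.mul_apply] at h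
    refine ihr (right_ne_zero_of_mul hp0) (fun a ha => hroots a (ha.dvd (dvd_mul_left r q))) hy ?_
    exact ihq (left_ne_zero_of_mul hp0) (fun a ha => hroots a (ha.dvd (dvd_mul_right q r)))
      (isBoundedUnder_norm_aeval_shift r hy) h

end NormedField

theorem distInt_nonneg (x : ℝ) : 0 ≤ distInt x := abs_nonneg _

theorem distInt_le_half (x : ℝ) : distInt x ≤ 1 / 2 := abs_sub_round x

theorem distInt_eq_abs_sub_intCast {x : ℝ} {m : ℤ} (h : |x - m| < 1 / 2) :
    distInt x = |x - m| := by
  have hround : round (x - m) = 0 :=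
    round_eq_zero_iff.2 ⟨by simpa using (abs_lt.1 h).1.le, (abs_lt.1 h).2⟩
  rw [round_sub_intCast, sub_eq_zero] at hround
  rw [distInt, hround]

theorem isBoundedUnder_distInt {ι : Type*} (f : Filter ι) (x : ι → ℝ) :
    f.IsBoundedUnder (· ≤ ·) fun i => distInt (x i) :=
  isBoundedUnder_of ⟨1 / 2, fun i => distInt_le_half (x i)⟩

theorem spectrumL_subset_Icc (P : ℤ[X]) (k : ℕ) : spectrumL P k ⊆ Icc 0 (1 / 2) := by
  rintro t ⟨g, -, rfl⟩
  refine ⟨?_, ?_⟩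
  · exact le_limsup_of_frequently_le (Frequently.of_forall fun n => distInt_nonneg _)
      (isBoundedUnder_distInt _ _)
  · exact limsup_le_of_le
      (isBoundedUnder_ge_of_nonneg fun n => distInt_nonneg _).isCoboundedUnder_le
      (Eventually.of_forall fun n => distInt_le_half _)

theorem zero_mem_spectrumL (P : ℤ[X]) (k : ℕ) : 0 ∈ spectrumL P k := by
  refine ⟨0, fun α _ => ⟨by simp, fun _ => ⟨0, by simp⟩, by simp⟩, ?_⟩
  simp [recSeq, recSumC, distInt]

theorem Hyperbolic.pow {P : ℤ[X]} (hP : Hyperbolic P) (n : ℕ) : Hyperbolic (P ^ n) := by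
  intro z hz
  simp only [rootSetC, Polynomial.map_pow, roots_pow, Multiset.mem_toFinset] at hz
  exact hP z (Multiset.mem_toFinset.2 (Multiset.mem_of_mem_nsmul hz))

theorem aeval_shift_recSumC {P : ℤ[X]} {k : ℕ} {g : ℂ → ℂ[X]} (hg : g ∈ coeffFamilies P k) :
    aeval (shift ℂ) ((P ^ (k + 1)).map (Int.castRingHom ℂ)) (fun n => recSumC P g n) = 0 := by
  have hsum : (fun n : ℕ => recSumC P g n) =
      ∑ α ∈ expandingRoots P, fun n : ℕ => (g α).eval (n : ℂ) * α ^ n := by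
    funext n
    simp [recSumC]
  rw [hsum, map_sum, Polynomial.map_pow]
  refine Finset.sum_eq_zero fun α hα => aeval_shift_pow_eq_zero_of_isRoot ?_ (hg α hα).1
  exact isRoot_of_mem_roots (Multiset.mem_toFinset.1 (Finset.mem_filter.1 hα).1)

theorem eventually_aeval_shift_eq_zero_of_intValued {p : ℂ[X]} {y : ℕ → ℂ} {B : ℝ}
    (hB : (p.sum fun _ a => ‖a‖) * B < 1) (hy : ∀ᶠ n in atTop, ‖y n‖ ≤ B)
    (hint : ∀ n, ∃ m : ℤ, aeval (shift ℂ) p y n = m) :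
    ∀ᶠ n in atTop, aeval (shift ℂ) p y n = 0 := by
  obtain ⟨N, hN⟩ := eventually_atTop.1 hy
  filter_upwards [eventually_ge_atTop N] with n hn
  obtain ⟨m, hm⟩ := hint n
  have hlt := (norm_aeval_shift_le p fun i hi => hN i (hn.trans hi)).trans_lt hB
  rw [hm, Complex.norm_intCast] at hlt
  have hm0 : m = 0 := Int.abs_lt_one_iff.1 (by exact_mod_cast hlt)
  rw [hm, hm0, Int.cast_zero]

theorem exists_pos_tendsto_distInt_of_limsup_lt {Q : ℤ[X]} (hQ : Q ≠ 0) (hyp : Hyperbolic Q) :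
    ∃ ε > 0, ∀ x : ℕ → ℝ,
      aeval (shift ℂ) (Q.map (Int.castRingHom ℂ)) (fun n => (x n : ℂ)) = 0 →
      limsup (fun n => distInt (x n)) atTop < ε →
      Tendsto (fun n => distInt (x n)) atTop (𝓝 0) := by
  set q := Q.map (Int.castRingHom ℂ) with hq
  have hq0 : q ≠ 0 := (Polynomial.map_ne_zero_iff (RingHom.injective_int _)).2 hQ
  have hA : 0 ≤ q.sum fun _ a => ‖a‖ := Finset.sum_nonneg fun _ _ => norm_nonneg _
  refine ⟨1 / ((q.sum fun _ a => ‖a‖) + 1), by positivity, fun x hx hlim => ?_⟩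
  let y : ℕ → ℂ := fun n => x n - round (x n)
  have hnorm (n : ℕ) : ‖y n‖ = distInt (x n) := by
    rw [distInt, ← Real.norm_eq_abs, ← Complex.norm_real]
    simp [y]
  have hint (n : ℕ) : ∃ m : ℤ, aeval (shift ℂ) q y n = m := by
    have hy : y = (fun n => (x n : ℂ)) - fun n => Int.castRingHom ℂ (round (x n)) := rfl
    refine ⟨-aeval (shift ℤ) Q (fun n => round (x n)) n, ?_⟩
    rw [hy, map_sub, hx, Pi.sub_apply, hq, aeval_shift_map_apply]
    simp
  have hzero : ∀ᶠ n in atTop, aeval (shift ℂ) q y n = 0 := by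
    refine eventually_aeval_shift_eq_zero_of_intValued
      (B := 1 / ((q.sum fun _ a => ‖a‖) + 1)) ?_ ?_ hint
    · rw [mul_one_div, div_lt_one (by positivity)]
      exact lt_add_one _
    · simp only [hnorm]
      exact (eventually_lt_of_limsup_lt hlim (isBoundedUnder_distInt _ _)).mono fun _ => le_of_lt
  have hroots (a : ℂ) (ha : q.IsRoot a) : ‖a‖ ≠ 1 :=
    hyp a (Multiset.mem_toFinset.2 ((mem_roots hq0).2 ha))
  have hy : Tendsto y atTop (𝓝 0) :=
    tendsto_zero_of_tendsto_aeval_shift (IsAlgClosed.splits q) hq0 hroots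
      (by simpa only [hnorm] using isBoundedUnder_distInt atTop x)
      (tendsto_const_nhds.congr' (hzero.mono fun _ => Eq.symm))
  simpa only [hnorm] using tendsto_zero_iff_norm_tendsto_zero.1 hy

theorem Hyperbolic.isIsolatedPoint {P : ℤ[X]} (hP0 : P ≠ 0) (hP : Hyperbolic P) (k : ℕ) :
    IsIsolatedPoint 0 (spectrumL P k) := by
  obtain ⟨ε, hε, h⟩ := exists_pos_tendsto_distInt_of_limsup_lt (pow_ne_zero (k + 1) hP0) (hP.pow _)
  refine ⟨zero_mem_spectrumL P k, ε, hε, ?_⟩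
  rintro t ⟨g, hg, rfl⟩ ht
  rw [sub_zero] at ht
  refine (h (fun n => recSeq P g n) ?_ ((le_abs_self _).trans_lt ht)).limsup_eq
  simpa only [coe_recSeq hg] using aeval_shift_recSumC hg

theorem aeval_mem_of_isSymmetric {R S σ : Type*} [CommRing R] [CommRing S] [Algebra R S]
    [Fintype σ] {A : Subalgebra R S} {f : σ → S}
    (hf : ∀ n, (Finset.univ.val.map f).esymm n ∈ A) {q : MvPolynomial σ R} (hq : q.IsSymmetric) :
    MvPolynomial.aeval f q ∈ A := by
  obtain ⟨r, hr⟩ := MvPolynomial.esymmAlgHom_surjective R le_rfl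
    (⟨q, hq⟩ : MvPolynomial.symmetricSubalgebra σ R)
  have hqr : q = MvPolynomial.aeval (fun i : Fin _ => MvPolynomial.esymm σ R (i + 1)) r := by
    rw [← MvPolynomial.esymmAlgHom_apply, hr]
  rw [hqr, MvPolynomial.comp_aeval_apply]
  simp only [MvPolynomial.aeval_esymm_eq_multiset_esymm]
  exact (Subalgebra.mvPolynomial_aeval_coe A (fun i : Fin _ => ⟨_, hf (i + 1)⟩) r).symm ▸
    Subtype.prop _

theorem multiset_sum_pow_mem {R S : Type*} [CommRing R] [CommRing S] [Algebra R S]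
    {A : Subalgebra R S} {s : Multiset S} (hs : ∀ n, s.esymm n ∈ A) (n : ℕ) :
    (s.map (· ^ n)).sum ∈ A := by
  classical
  have hpsum := aeval_mem_of_isSymmetric (f := fun i : s => (i : S))
    (by rwa [Multiset.map_univ_coe]) (MvPolynomial.psum_isSymmetric s R n)
  have hsum : ∑ i : s, (i : S) ^ n = (s.map (· ^ n)).sum :=
    congrArg Multiset.sum (Multiset.map_univ s (· ^ n))
  simpa [MvPolynomial.psum, hsum] using hpsum

theorem esymm_aroots_mem_bot {R S : Type*} [CommRing R] [CommRing S] [IsDomain S] [Algebra R S]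
    {p : R[X]} (hp : p.Monic) (hsplit : (p.map (algebraMap R S)).Splits) (n : ℕ) :
    (p.aroots S).esymm n ∈ (⊥ : Subalgebra R S) := by
  have hcard : (p.aroots S).card = p.natDegree := by
    rw [← hsplit.natDegree_eq_card_roots, hp.natDegree_map]
  rcases le_or_gt n p.natDegree with hn | hn
  · refine Algebra.mem_bot.2 ⟨(-1) ^ n * p.coeff (p.natDegree - n), ?_⟩
    have hcoeff := coeff_eq_esymm_roots_of_card (p := p.map (algebraMap R S))
      (by rw [hcard, hp.natDegree_map]) ((Nat.sub_le _ n).trans_eq (hp.natDegree_map _).symm)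
    rw [(hp.map _).leadingCoeff, one_mul, hp.natDegree_map, Nat.sub_sub_self hn, coeff_map]
      at hcoeff
    rw [map_mul, hcoeff, aroots_def, ← mul_assoc, map_pow, map_neg, map_one, ← mul_pow]
    simp
  · rw [Multiset.esymm, Multiset.powersetCard_eq_empty _ (hcard.trans_lt hn)]
    exact zero_mem _

theorem exists_pow_sum_norm_sub_one_lt {s : Finset ℂ} (hs : ∀ β ∈ s, ‖β‖ = 1) (w : ℂ → ℝ) {δ : ℝ}
    (hδ : 0 < δ) : ∃ h : ℕ, 0 < h ∧ ∑ β ∈ s, w β * ‖β ^ h - 1‖ < δ := by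
  let x : s → Circle := fun β => ⟨β, mem_sphere_zero_iff_norm.2 (hs β β.2)⟩
  let F : (s → Circle) → ℝ := fun z => ∑ β : s, w β * ‖(z β : ℂ) - 1‖
  have hF : Continuous F := by fun_prop
  have hmem : {z | F z < δ} ∈ 𝓝 (1 : s → Circle) :=
    (isOpen_lt hF continuous_const).mem_nhds (by simpa [F])
  obtain ⟨h, hh, hlt⟩ := ((mapClusterPt_one_atTop_pow x).frequently hmem).and_eventually
    (eventually_gt_atTop 0) |>.exists
  have hcoe (β : s) : ((x ^ h) β : ℂ) = β ^ h := Circle.coe_pow (x β) h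
  refine ⟨h, hlt, ?_⟩
  rw [← Finset.sum_coe_sort]
  simpa only [F, mem_ofPred_eq, hcoe] using hh

theorem eq_zero_of_tendsto_sum_pow {𝕜 : Type*} [NormedField 𝕜] {s : Finset 𝕜}
    (hs : ∀ β ∈ s, ‖β‖ = 1) {c : 𝕜 → 𝕜}
    (h : Tendsto (fun n : ℕ => ∑ β ∈ s, c β * β ^ n) atTop (𝓝 0)) {β : 𝕜} (hβ : β ∈ s) :
    c β = 0 := by
  classical
  set r : 𝕜[X] := ∏ γ ∈ s.erase β, (X - C γ)
  have hrβ : r.eval β ≠ 0 := by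
    simpa [r, eval_prod, Finset.prod_ne_zero_iff, sub_eq_zero] using fun γ hγ _ => Ne.symm hγ
  have hrγ : ∀ γ ∈ s, γ ≠ β → r.eval γ = 0 := fun γ hγ hne => by
    rw [eval_prod]
    exact Finset.prod_eq_zero (Finset.mem_erase.2 ⟨hne, hγ⟩) (by simp)
  have hisolate : aeval (shift 𝕜) r (fun n : ℕ => ∑ β ∈ s, c β * β ^ n) =
      fun n => r.eval β * c β * β ^ n := by
    have hsum : (fun n : ℕ => ∑ β ∈ s, c β * β ^ n) = ∑ β ∈ s, fun n : ℕ => c β * β ^ n := by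
      funext n
      simp
    rw [hsum, map_sum, Finset.sum_eq_single_of_mem β hβ, aeval_shift_geometric]
    intro γ hγ hne
    simp [aeval_shift_geometric, hrγ γ hγ hne, Pi.zero_def]
  have hnorm := (hisolate ▸ tendsto_aeval_shift r h).norm
  simp only [norm_mul, norm_pow, hs β hβ, one_pow, mul_one, norm_zero] at hnorm
  simpa [hrβ] using tendsto_nhds_unique tendsto_const_nhds hnorm

section Weights

variable {P : ℤ[X]} {c : ℂ → ℂ}

/-- Conjugation-invariant weights `c` on the roots of `P` whose weighted power sums
`∑ c(β) β ^ n`, over all roots `β`, are integers. The expanding part of such a power sum is the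
sequence of the constant coefficient family `c`, and its distance to the nearest integer is governed
by the part on the unit circle. -/
structure IsIntegralWeight (P : ℤ[X]) (c : ℂ → ℂ) : Prop where
  map_conj : ∀ z, c (starRingEnd ℂ z) = starRingEnd ℂ (c z)
  exists_int : ∀ n : ℕ, ∃ m : ℤ, ∑ β ∈ rootSetC P, c β * β ^ n = m

theorem IsIntegralWeight.natCast_mul (hc : IsIntegralWeight P c) (m : ℕ) :
    IsIntegralWeight P fun z => m * c z where
  map_conj z := by simp [hc.map_conj]
  exists_int n := by
    obtain ⟨u, hu⟩ := hc.exists_int n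
    refine ⟨m * u, ?_⟩
    simp only [mul_assoc, ← Finset.mul_sum, hu, Int.cast_mul, Int.cast_natCast]

theorem rootMultiplicity_conj (P : ℤ[X]) (z : ℂ) :
    (P.map (Int.castRingHom ℂ)).rootMultiplicity (starRingEnd ℂ z) =
      (P.map (Int.castRingHom ℂ)).rootMultiplicity z := by
  rw [eq_rootMultiplicity_map (f := starRingEnd ℂ) (RingHom.injective _) z, Polynomial.map_map]
  congr 2
  exact RingHom.ext_int _ _

theorem isIntegralWeight_rootMultiplicity_mul (hmonic : P.Monic) (h : ℕ) :
    IsIntegralWeight P fun z =>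
      (P.map (Int.castRingHom ℂ)).rootMultiplicity z * (z ^ h - 1) where
  map_conj z := by simp [rootMultiplicity_conj]
  exists_int n := by
    have hpow (n : ℕ) : ∃ m : ℤ, ∑ β ∈ rootSetC P,
        (P.map (Int.castRingHom ℂ)).rootMultiplicity β * β ^ n = m := by
      obtain ⟨m, hm⟩ := Algebra.mem_bot.1 <| multiset_sum_pow_mem
        (esymm_aroots_mem_bot hmonic (IsAlgClosed.splits (P.map (algebraMap ℤ ℂ)))) n
      refine ⟨m, ?_⟩
      rw [aroots_def, Finset.sum_multiset_map_count] at hm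
      simpa [rootSetC] using hm.symm
    obtain ⟨a, ha⟩ := hpow (n + h)
    obtain ⟨b, hb⟩ := hpow n
    refine ⟨a - b, ?_⟩
    rw [Int.cast_sub, ← ha, ← hb, ← Finset.sum_sub_distrib]
    exact Finset.sum_congr rfl fun β _ => by ring

/-- The part of the weighted power sum `∑ c(β) β ^ n` over the roots `β` of `P` that comes from the
roots on the unit circle. -/
noncomputable def unitCircleSum (P : ℤ[X]) (c : ℂ → ℂ) (n : ℕ) : ℂ :=
  ∑ β ∈ rootSetC P with ‖β‖ = 1, c β * β ^ n

theorem norm_unitCircleSum_le (P : ℤ[X]) (c : ℂ → ℂ) (n : ℕ) :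
    ‖unitCircleSum P c n‖ ≤ ∑ β ∈ rootSetC P with ‖β‖ = 1, ‖c β‖ :=
  norm_sum_le_of_le _ fun β hβ => by simp [(Finset.mem_filter.1 hβ).2]

theorem isBoundedUnder_norm_unitCircleSum (P : ℤ[X]) (c : ℂ → ℂ) :
    IsBoundedUnder (· ≤ ·) atTop fun n => ‖unitCircleSum P c n‖ :=
  isBoundedUnder_of ⟨_, norm_unitCircleSum_le P c⟩

theorem unitCircleSum_const_mul (P : ℤ[X]) (a : ℂ) (c : ℂ → ℂ) (n : ℕ) :
    unitCircleSum P (fun z => a * c z) n = a * unitCircleSum P c n := by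
  simp only [unitCircleSum, mul_assoc, Finset.mul_sum]

theorem tendsto_sum_rootSetC_sub (P : ℤ[X]) (c : ℂ → ℂ) :
    Tendsto (fun n : ℕ => ∑ β ∈ rootSetC P, c β * β ^ n -
      ∑ α ∈ expandingRoots P, c α * α ^ n - unitCircleSum P c n) atTop (𝓝 0) := by
  have hdecay : Tendsto (fun n : ℕ => ∑ β ∈ rootSetC P with ‖β‖ < 1, c β * β ^ n) atTop (𝓝 0) := by
    simpa using tendsto_finsetSum ((rootSetC P).filter fun β => ‖β‖ < 1) fun β hβ =>
      (tendsto_pow_atTop_nhds_zero_of_norm_lt_one (Finset.mem_filter.1 hβ).2).const_mul (c β)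
  refine hdecay.congr fun n => ?_
  simp only [unitCircleSum, expandingRoots, Finset.sum_filter, ← Finset.sum_sub_distrib]
  refine Finset.sum_congr rfl fun β _ => ?_
  rcases lt_trichotomy ‖β‖ 1 with h | h | h
  · simp [h, h.ne, h.not_gt]
  · simp [h]
  · simp [h, h.ne', h.not_gt]

theorem const_mem_coeffFamilies (P : ℤ[X]) (k : ℕ)
    (hc : ∀ z, c (starRingEnd ℂ z) = starRingEnd ℂ (c z)) :
    (fun z => C (c z)) ∈ coeffFamilies P k := by
  refine fun α _ => ⟨degree_C_le.trans (by exact_mod_cast k.zero_le), fun hα => ?_, by simp [hc]⟩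
  obtain ⟨r, hr⟩ := Complex.conj_eq_iff_real.1
    (show starRingEnd ℂ (c α) = c α by rw [← hc, Complex.conj_eq_iff_im.2 hα])
  exact ⟨C r, by simp [hr]⟩

theorem IsIntegralWeight.limsup_mem_spectrumL (hc : IsIntegralWeight P c) (k : ℕ)
    (hlim : limsup (fun n => ‖unitCircleSum P c n‖) atTop < 1 / 2) :
    limsup (fun n => ‖unitCircleSum P c n‖) atTop ∈ spectrumL P k := by
  have hg := const_mem_coeffFamilies P k hc.map_conj
  refine ⟨fun z => C (c z), hg, ?_⟩
  choose u hu using hc.exists_int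
  set x : ℕ → ℝ := fun n => recSeq P (fun z => C (c z)) n
  have hx (n : ℕ) : (x n : ℂ) = ∑ α ∈ expandingRoots P, c α * α ^ n := by
    simp [x, coe_recSeq hg, recSumC]
  have hsub : Tendsto ((fun n => |x n - u n|) - fun n => ‖unitCircleSum P c n‖) atTop (𝓝 0) := by
    refine squeeze_zero_norm (fun n => ?_)
      (tendsto_zero_iff_norm_tendsto_zero.1 (tendsto_sum_rootSetC_sub P c))
    have hcoe : |x n - u n| = ‖(u n - x n : ℂ)‖ := by
      rw [← Real.norm_eq_abs, ← Complex.norm_real, norm_sub_rev (u n : ℂ)]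
      simp
    rw [hu, ← hx, Pi.sub_apply, hcoe]
    exact abs_norm_sub_norm_le _ _
  have hbdd := isBoundedUnder_norm_unitCircleSum P c
  have heq : limsup (fun n => |x n - u n|) atTop = limsup (fun n => ‖unitCircleSum P c n‖) atTop :=
    limsup_eq_of_tendsto_sub hbdd (isBoundedUnder_ge_of_nonneg fun n => norm_nonneg _) hsub
  have hxu : IsBoundedUnder (· ≤ ·) atTop fun n => |x n - u n| := by
    simpa using isBoundedUnder_le_add hsub.isBoundedUnder_le hbdd
  rw [← heq] at hlim ⊢
  refine limsup_congr ((eventually_lt_of_limsup_lt hlim hxu).mono fun n hn => ?_)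
  exact (distInt_eq_abs_sub_intCast hn).symm

theorem exists_isIntegralWeight_limsup_lt (hmonic : P.Monic) {β : ℂ} (hβ : β ∈ rootSetC P)
    (hnorm : ‖β‖ = 1) (hpow : ∀ n : ℕ, 0 < n → β ^ n ≠ 1) {δ : ℝ} (hδ : 0 < δ) :
    ∃ c, IsIntegralWeight P c ∧ 0 < limsup (fun n => ‖unitCircleSum P c n‖) atTop ∧
      limsup (fun n => ‖unitCircleSum P c n‖) atTop < δ := by
  set mult : ℂ → ℕ := (P.map (Int.castRingHom ℂ)).rootMultiplicity
  have hcircle : ∀ γ ∈ {γ ∈ rootSetC P | ‖γ‖ = 1}, ‖γ‖ = 1 := fun γ hγ => (Finset.mem_filter.1 hγ).2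
  obtain ⟨h, hh, hlt⟩ := exists_pow_sum_norm_sub_one_lt hcircle (fun γ => mult γ) hδ
  refine ⟨_, isIntegralWeight_rootMultiplicity_mul hmonic h, ?_, ?_⟩
  · by_contra! hle
    have hzero := eq_zero_of_tendsto_sum_pow hcircle (tendsto_zero_of_limsup_norm_le_zero
      (isBoundedUnder_norm_unitCircleSum P _) hle) (Finset.mem_filter.2 ⟨hβ, hnorm⟩)
    have hmult : (P.map (Int.castRingHom ℂ)).rootMultiplicity β ≠ 0 := by
      rw [← count_roots]
      exact Multiset.count_ne_zero.2 (Multiset.mem_toFinset.1 hβ)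
    exact hpow h hh (sub_eq_zero.1 ((mul_eq_zero.1 hzero).resolve_left (by exact_mod_cast hmult)))
  · refine (limsup_le_of_le (isBoundedUnder_ge_of_nonneg fun n => norm_nonneg _).isCoboundedUnder_le
      (Eventually.of_forall fun n => ?_)).trans_lt hlt
    simpa [mult] using norm_unitCircleSum_le P (fun z => mult z * (z ^ h - 1)) n

theorem isDenseIn_spectrumL (hmonic : P.Monic) {β : ℂ} (hβ : β ∈ rootSetC P) (hnorm : ‖β‖ = 1)
    (hpow : ∀ n : ℕ, 0 < n → β ^ n ≠ 1) (k : ℕ) : IsDenseIn (spectrumL P k) (Icc 0 (1 / 2)) := by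
  refine ⟨spectrumL_subset_Icc P k, Icc_subset_closure_of_natCast_mul_mem (by norm_num) ?_⟩
  intro δ hδ
  obtain ⟨c, hc, hpos, hlt⟩ := exists_isIntegralWeight_limsup_lt hmonic hβ hnorm hpow hδ
  refine ⟨_, hpos, hlt, fun m hm => ?_⟩
  have hscale : limsup (fun n => ‖unitCircleSum P (fun z => m * c z) n‖) atTop =
      m * limsup (fun n => ‖unitCircleSum P c n‖) atTop := by
    simp only [unitCircleSum_const_mul, norm_mul, Complex.norm_natCast]
    exact limsup_const_mul_of_nonneg m.cast_nonneg (isBoundedUnder_norm_unitCircleSum P c)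
      (isBoundedUnder_ge_of_nonneg fun n => norm_nonneg _)
  rw [← hscale] at hm ⊢
  exact (hc.natCast_mul m).limsup_mem_spectrumL k hm

end Weights

theorem Admissible.pow_ne_one {P : ℤ[X]} (hP : Admissible P) (hmonic : P.Monic) {β : ℂ}
    (hβ : β ∈ rootSetC P) {n : ℕ} (hn : 0 < n) : β ^ n ≠ 1 := by
  intro hone
  have hroot : aeval β P = 0 := by
    simpa [aeval_def, eval_map] using isRoot_of_mem_roots (Multiset.mem_toFinset.1 hβ)
  have hint : IsIntegral ℤ β := ⟨P, hmonic, by simpa [aeval_def] using hroot⟩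
  obtain ⟨z, hz, hz1⟩ := hP.exists_expanding_root (minpoly ℤ β) (minpoly.irreducible hint)
    (minpoly.isIntegrallyClosed_dvd hint hroot)
  have hdvd : minpoly ℤ β ∣ X ^ n - 1 := minpoly.isIntegrallyClosed_dvd hint (by simp [hone])
  have hzn : z ^ n = 1 := by
    simpa [sub_eq_zero] using aeval_eq_zero_of_dvd_aeval_eq_zero hdvd hz
  exact hz1.ne' (Complex.norm_eq_one_of_pow_eq_one hzn hn.ne')

end MarkoffLagrange

theorem theorem4p2_general (P : ℤ[X]) (hmonic : P.Monic)
    (hpow : ∀ z ∈ MarkoffLagrange.rootSetC P, ∀ n : ℕ, 0 < n → z ^ n ≠ 1) (k : ℕ) :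
    (MarkoffLagrange.IsIsolatedPoint 0 (MarkoffLagrange.spectrumL P k) ↔
      MarkoffLagrange.Hyperbolic P) ∧
    (¬ MarkoffLagrange.Hyperbolic P →
      MarkoffLagrange.IsDenseIn (MarkoffLagrange.spectrumL P k) (Set.Icc (0 : ℝ) (1 / 2))) := by
  have hdense (hyp : ¬ MarkoffLagrange.Hyperbolic P) :
      MarkoffLagrange.IsDenseIn (MarkoffLagrange.spectrumL P k) (Set.Icc (0 : ℝ) (1 / 2)) := by
    simp only [MarkoffLagrange.Hyperbolic, not_forall, not_not] at hyp
    obtain ⟨β, hβ, hnorm⟩ := hyp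
    exact MarkoffLagrange.isDenseIn_spectrumL hmonic hβ hnorm (hpow β hβ) k
  refine ⟨⟨fun hiso => ?_, fun hyp => hyp.isIsolatedPoint hmonic.ne_zero k⟩, hdense⟩
  by_contra hyp
  exact (hdense hyp).not_isIsolatedPoint (by norm_num) hiso

theorem theorem4p2 (P : Polynomial ℤ) (hP : MarkoffLagrange.Admissible P) (hmonic : P.Monic)
    (k : ℕ) :
    (MarkoffLagrange.IsIsolatedPoint 0 (MarkoffLagrange.spectrumL P k) ↔
      MarkoffLagrange.Hyperbolic P) ∧
    (¬ MarkoffLagrange.Hyperbolic P →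
      MarkoffLagrange.IsDenseIn (MarkoffLagrange.spectrumL P k) (Set.Icc (0 : ℝ) (1 / 2))) :=
  theorem4p2_general P hmonic (fun _ hz _ hn => hP.pow_ne_one hmonic hz hn) k
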